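/- Let $q\in\mathbb C$ with $|q|=1$. Call a pair $(A_1,A_2)$ of bounded operators on a complex Hilbert space $q$-commuting if $A_1A_2=qA_2A_1$, and call two pairs $(A_1,A_2)$ on $\mathcal H$ and $(B_1,B_2)$ on $\mathcal H'$ unitarily equivalent if there is a unitary $\psi:\mathcal H\to\mathcal H'$ with $\psi A_i=B_i\psi$ for $i=1,2$. Let $(T_1,T_2)$ be a $q$-commuting pair of contractions on a Hilbert space $\mathcal H$ and put $T=T_1T_2$. Let $Q_{T^*}$ be the positive square root of the strong operator limit of $T^nT^{*n}$, and let $X^*,X_1^*,X_2^*$ be the operators on $\overline{\operatorname{Ran}}\,Q_{T^*}$ determined by $X^*Q_{T^*}h=Q_{T^*}T^*h$ and $X_i^*Q_{T^*}h=Q_{T^*}T_i^*h$ for $h\in\mathcal H$. Let $W_D^*$ on $\mathcal Q_{T^*}\supseteq\overline{\operatorname{Ran}}\,Q_{T^*}$ be the minimal unitary extension of the isometry $X^*$, i.e. $W_D$ is unitary, $W_D^*$ extends $X^*$, and $\mathcal Q_{T^*}$ is the closed linear span of the subspaces $W_D^n\,\overline{\operatorname{Ran}}\,Q_{T^*}$,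 $n\ge0$. A canonical $q$-commuting pair of unitaries associated with $(T_1,T_2)$ is a $q$-commuting pair $(W_1,W_2)$ of unitaries on $\mathcal Q_{T^*}$ such that $W_i^*$ extends $X_i^*$ for $i=1,2$ and $W_1^*W_2^*=qW_D^*$. Such a minimal unitary extension exists, and on each such $\mathcal Q_{T^*}$ a canonical pair exists. Moreover, let $(T_1,T_2)$ on $\mathcal H$ and $(T_1',T_2')$ on $\mathcal H'$ be two $q$-commuting pairs of contractions with canonical $q$-commuting pairs of unitaries $(W_1,W_2)$ on $\mathcal Q_{T^*}$ and $(W_1',W_2')$ on $\mathcal Q_{T'^*}$, respectively. If $(T_1,T_2)$ and $(T_1',T_2')$ are unitarily equivalent, then so are $(W_1,W_2)$ and $(W_1',W_2')$. In particular, if $(T_1,T_2)=(T_1',T_2')$ (so that $\mathcal Q_{T^*}=\mathcal Q_{T'^*}$ and $W_D=W_D'$), then $(W_1,W_2)=(W_1',W_2')$. -/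

import Mathlib

open Filter Topology

noncomputable section

namespace QCommuting

section AsymptoticLimit

variable {H : Type*} [NormedAddCommGroup H] [InnerProductSpace ℂ H] [CompleteSpace H]

/-- `T₁ T₂ = q T₂ T₁`. -/
def IsQCommuting (q : ℂ) (T₁ T₂ : H →L[ℂ] H) : Prop := T₁ * T₂ = q • (T₂ * T₁)

/-- A `q`-commuting pair of contractions. -/
structure IsQCommutingContractivePair (q : ℂ) (T₁ T₂ : H →L[ℂ] H) : Prop where
  qcomm : IsQCommuting q T₁ T₂
  contr₁ : ‖T₁‖ ≤ 1
  contr₂ : ‖T₂‖ ≤ 1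

theorem IsQCommutingContractivePair.contr_mul {q : ℂ} {T₁ T₂ : H →L[ℂ] H}
    (h : IsQCommutingContractivePair q T₁ T₂) : ‖T₁ * T₂‖ ≤ 1 :=
  (norm_mul_le _ _).trans (mul_le_one₀ h.contr₁ (norm_nonneg _) h.contr₂)

theorem norm_apply_le_of_contr {T : H →L[ℂ] H} (hT : ‖T‖ ≤ 1) (x : H) : ‖T x‖ ≤ ‖x‖ := by
  simpa using T.le_of_opNorm_le hT x

theorem contr_star {T : H →L[ℂ] H} (hT : ‖T‖ ≤ 1) : ‖star T‖ ≤ 1 := by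
  rwa [norm_star]

theorem contr_pow {T : H →L[ℂ] H} (hT : ‖T‖ ≤ 1) (n : ℕ) : ‖T ^ n‖ ≤ 1 := by
  induction n with
  | zero =>
    rw [pow_zero]
    exact ContinuousLinearMap.norm_id_le
  | succ n ih =>
    rw [pow_succ]
    exact (norm_mul_le _ _).trans (mul_le_one₀ ih (norm_nonneg _) hT)

theorem norm_sub_mul_star_apply_sq_le {B : H →L[ℂ] H} (hB : ‖B‖ ≤ 1) (x : H) :
    ‖x - B (star B x)‖ ^ 2 ≤ ‖x‖ ^ 2 - ‖star B x‖ ^ 2 := by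
  have h1 : RCLike.re (inner ℂ x (B (star B x))) = ‖star B x‖ ^ 2 := by
    rw [ContinuousLinearMap.star_eq_adjoint, ← ContinuousLinearMap.adjoint_inner_left,
      inner_self_eq_norm_sq]
  have h2 : ‖B (star B x)‖ ^ 2 ≤ ‖star B x‖ ^ 2 := by
    gcongr
    exact norm_apply_le_of_contr hB _
  rw [@norm_sub_sq ℂ, h1]
  linarith

theorem antitone_norm_star_pow {T : H →L[ℂ] H} (hT : ‖T‖ ≤ 1) (h : H) :
    Antitone fun n : ℕ => ‖(star T ^ n) h‖ ^ 2 := by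
  refine antitone_nat_of_succ_le fun n => ?_
  gcongr
  rw [pow_succ', mul_apply_eq_comp]
  exact norm_apply_le_of_contr (contr_star hT) _

theorem norm_pow_mul_star_pow_sub_sq_le {T : H →L[ℂ] H} (hT : ‖T‖ ≤ 1) (h : H) {m n : ℕ}
    (hmn : m ≤ n) : ‖(T ^ m * star T ^ m) h - (T ^ n * star T ^ n) h‖ ^ 2
      ≤ ‖(star T ^ m) h‖ ^ 2 - ‖(star T ^ n) h‖ ^ 2 := by
  obtain ⟨k, rfl⟩ := Nat.exists_eq_add_of_le hmn
  have key := norm_sub_mul_star_apply_sq_le (contr_pow hT k) ((star T ^ m) h)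
  have e1 : (star T ^ (m + k)) h = (star (T ^ k)) ((star T ^ m) h) := by
    rw [star_pow, ← mul_apply_eq_comp, ← pow_add, add_comm]
  have e2 : (T ^ m * star T ^ m) h - (T ^ (m + k) * star T ^ (m + k)) h
      = (T ^ m) ((star T ^ m) h - (T ^ k) ((star (T ^ k)) ((star T ^ m) h))) := by
    rw [map_sub, mul_apply_eq_comp, mul_apply_eq_comp, e1, pow_add,
      mul_apply_eq_comp]
  rw [e2, e1]
  refine le_trans ?_ key
  gcongr
  exact norm_apply_le_of_contr (contr_pow hT m) _

theorem exists_tendsto_pow_mul_star_pow {T : H →L[ℂ] H} (hT : ‖T‖ ≤ 1) (h : H) :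
    ∃ y, Tendsto (fun n : ℕ => (T ^ n * star T ^ n) h) atTop (𝓝 y) := by
  refine cauchySeq_tendsto_of_complete ?_
  have hc : CauchySeq fun n : ℕ => ‖(star T ^ n) h‖ ^ 2 :=
    (tendsto_atTop_ciInf (antitone_norm_star_pow hT h)
      ⟨0, by rintro _ ⟨n, rfl⟩; positivity⟩).cauchySeq
  rw [Metric.cauchySeq_iff'] at hc ⊢
  intro ε hε
  obtain ⟨N, hN⟩ := hc (ε ^ 2) (by positivity)
  refine ⟨N, fun n hn => ?_⟩
  have h1 := norm_pow_mul_star_pow_sub_sq_le hT h hn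
  have h2 := hN n hn
  rw [Real.dist_eq, abs_lt] at h2
  rw [dist_comm, dist_eq_norm]
  exact lt_of_pow_lt_pow_left₀ 2 hε.le (by linarith [h2.1])

/-- The strong operator limit of `Tⁿ T*ⁿ`, for a contraction `T`. -/
def asymptoticLimit (T : H →L[ℂ] H) (hT : ‖T‖ ≤ 1) : H →L[ℂ] H :=
  continuousLinearMapOfTendsto (l := atTop) (fun n : ℕ => T ^ n * star T ^ n)
    (f := fun h => (exists_tendsto_pow_mul_star_pow hT h).choose)
    (tendsto_pi_nhds.2 fun h => (exists_tendsto_pow_mul_star_pow hT h).choose_spec)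

theorem tendsto_asymptoticLimit (T : H →L[ℂ] H) (hT : ‖T‖ ≤ 1) (h : H) :
    Tendsto (fun n : ℕ => (T ^ n * star T ^ n) h) atTop (𝓝 (asymptoticLimit T hT h)) :=
  (exists_tendsto_pow_mul_star_pow hT h).choose_spec

theorem tendsto_inner_asymptoticLimit (T : H →L[ℂ] H) (hT : ‖T‖ ≤ 1) (h : H) :
    Tendsto (fun n : ℕ => ((‖(star T ^ n) h‖ ^ 2 : ℝ) : ℂ)) atTop
      (𝓝 (inner ℂ (asymptoticLimit T hT h) h)) := by
  refine ((tendsto_asymptoticLimit T hT h).inner tendsto_const_nhds).congr fun n => ?_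
  rw [mul_apply_eq_comp, ← ContinuousLinearMap.adjoint_inner_right,
    ← ContinuousLinearMap.star_eq_adjoint, star_pow, inner_self_eq_norm_sq_to_K]
  push_cast
  rfl

theorem asymptoticLimit_nonneg (T : H →L[ℂ] H) (hT : ‖T‖ ≤ 1) : 0 ≤ asymptoticLimit T hT := by
  rw [ContinuousLinearMap.nonneg_iff_isPositive, ContinuousLinearMap.isPositive_iff_complex]
  intro h
  have ht := tendsto_inner_asymptoticLimit T hT h
  have hre := (Complex.continuous_re.tendsto _).comp ht
  have him := (Complex.continuous_im.tendsto _).comp ht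
  have him0 : (inner ℂ (asymptoticLimit T hT h) h : ℂ).im = 0 :=
    tendsto_nhds_unique him
      (by simp [Function.comp_def, -Complex.ofReal_pow])
  refine ⟨Complex.ext (by simp) (by simp [him0]), ?_⟩
  refine ge_of_tendsto' hre fun n => ?_
  simp only [Function.comp_apply, Complex.ofReal_re]
  positivity

/-- `Q_{T*}`: the positive square root of the strong limit of `Tⁿ T*ⁿ`. -/
def Q (T : H →L[ℂ] H) (hT : ‖T‖ ≤ 1) : H →L[ℂ] H := CFC.sqrt (asymptoticLimit T hT)

theorem Q_nonneg (T : H →L[ℂ] H) (hT : ‖T‖ ≤ 1) : 0 ≤ Q T hT := CFC.sqrt_nonneg _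

theorem Q_mul_Q (T : H →L[ℂ] H) (hT : ‖T‖ ≤ 1) : Q T hT * Q T hT = asymptoticLimit T hT :=
  CFC.sqrt_mul_sqrt_self _ (asymptoticLimit_nonneg T hT)

theorem tendsto_norm_sq_Q (T : H →L[ℂ] H) (hT : ‖T‖ ≤ 1) (h : H) :
    Tendsto (fun n : ℕ => ‖(star T ^ n) h‖ ^ 2) atTop (𝓝 (‖Q T hT h‖ ^ 2)) := by
  have h1 : (inner ℂ (asymptoticLimit T hT h) h : ℂ) = ((‖Q T hT h‖ ^ 2 : ℝ) : ℂ) := by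
    rw [← Q_mul_Q, mul_apply_eq_comp, ← ContinuousLinearMap.adjoint_inner_right,
      ← ContinuousLinearMap.star_eq_adjoint, (IsSelfAdjoint.of_nonneg (Q_nonneg T hT)).star_eq,
      inner_self_eq_norm_sq_to_K]
    push_cast
    rfl
  have h2 := tendsto_inner_asymptoticLimit T hT h
  rw [h1] at h2
  simpa [Function.comp_def, ← Complex.ofReal_pow] using (Complex.continuous_re.tendsto _).comp h2

/-- The closure of the range of `Q_{T*}`, as a subspace of `H`. -/
def ranQ (T : H →L[ℂ] H) (hT : ‖T‖ ≤ 1) : Submodule ℂ H :=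
  (LinearMap.range (Q T hT : H →ₗ[ℂ] H)).topologicalClosure

instance (T : H →L[ℂ] H) (hT : ‖T‖ ≤ 1) : CompleteSpace (ranQ T hT) :=
  (Submodule.isClosed_topologicalClosure _).completeSpace_coe

/-- `Q_{T*}`, as a map into the closure of its range. -/
def toRanQ (T : H →L[ℂ] H) (hT : ‖T‖ ≤ 1) : H →L[ℂ] ranQ T hT :=
  (Q T hT).codRestrict (ranQ T hT) fun h => Submodule.le_topologicalClosure _ ⟨h, rfl⟩

theorem norm_toRanQ (T : H →L[ℂ] H) (hT : ‖T‖ ≤ 1) (h : H) : ‖toRanQ T hT h‖ = ‖Q T hT h‖ := rfl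

theorem denseRange_toRanQ (T : H →L[ℂ] H) (hT : ‖T‖ ≤ 1) : DenseRange (toRanQ T hT) := by
  intro x
  rw [closure_subtype]
  have hx : (x : H) ∈ closure (Set.range (Q T hT)) := x.2
  convert hx using 2
  rw [← Set.range_comp]
  rfl

/-- The operator `Xₛ* : closure (ran Q_{T*}) → closure (ran Q_{T*})` with
`Xₛ* Q_{T*} h = Q_{T*} S* h`, extended by continuity from the range of `Q_{T*}`. It is
used for `S = T`, `S = T₁` and `S = T₂`, where `T = T₁ T₂`; see `Xstar_mul`, `Xstar_fst`
and `Xstar_snd`. -/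
def Xstar (T : H →L[ℂ] H) (hT : ‖T‖ ≤ 1) (S : H →L[ℂ] H) : ranQ T hT →L[ℂ] ranQ T hT :=
  LinearMap.extendOfNorm ((toRanQ T hT ∘L star S : H →L[ℂ] ranQ T hT) : H →ₗ[ℂ] ranQ T hT)
    (toRanQ T hT : H →ₗ[ℂ] ranQ T hT)

theorem Xstar_apply {T : H →L[ℂ] H} {hT : ‖T‖ ≤ 1} {S : H →L[ℂ] H}
    (hS : ∀ (n : ℕ) (h : H), ‖(star T ^ n) (star S h)‖ ≤ ‖(star T ^ n) h‖) (h : H) :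
    Xstar T hT S (toRanQ T hT h) = toRanQ T hT (star S h) := by
  refine LinearMap.extendOfNorm_eq (denseRange_toRanQ T hT) ⟨1, fun x => ?_⟩ h
  have h1 : ‖Q T hT (star S x)‖ ^ 2 ≤ ‖Q T hT x‖ ^ 2 :=
    le_of_tendsto_of_tendsto' (tendsto_norm_sq_Q T hT (star S x)) (tendsto_norm_sq_Q T hT x)
      fun n => by gcongr; exact hS n x
  change ‖Q T hT (star S x)‖ ≤ 1 * ‖Q T hT x‖
  rw [one_mul]
  exact le_of_sq_le_sq h1 (norm_nonneg _)

theorem norm_pow_apply_le_of_qcomm {c : ℂ} (hc : ‖c‖ = 1) {A B : H →L[ℂ] H} (hB : ‖B‖ ≤ 1)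
    (hAB : A * B = c • (B * A)) (n : ℕ) (h : H) : ‖(A ^ n) (B h)‖ ≤ ‖(A ^ n) h‖ := by
  have key : A ^ n * B = c ^ n • (B * A ^ n) := by
    induction n with
    | zero => simp
    | succ n ih =>
      rw [pow_succ, mul_assoc, hAB, mul_smul_comm, ← mul_assoc, ih, smul_mul_assoc, smul_smul,
        mul_assoc, pow_succ' c]
  rw [← mul_apply_eq_comp, key]
  simpa [norm_smul, hc] using norm_apply_le_of_contr hB ((A ^ n) h)

theorem Xstar_mul {T : H →L[ℂ] H} {hT : ‖T‖ ≤ 1} (h : H) :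
    Xstar T hT T (toRanQ T hT h) = toRanQ T hT (star T h) :=
  Xstar_apply (norm_pow_apply_le_of_qcomm (c := 1) (by simp) (contr_star hT) (by simp)) h

theorem Xstar_fst {q : ℂ} (hq : ‖q‖ = 1) {T₁ T₂ : H →L[ℂ] H}
    (hT : IsQCommutingContractivePair q T₁ T₂) (h : H) :
    Xstar (T₁ * T₂) hT.contr_mul T₁ (toRanQ (T₁ * T₂) hT.contr_mul h)
      = toRanQ (T₁ * T₂) hT.contr_mul (star T₁ h) := by
  refine Xstar_apply (norm_pow_apply_le_of_qcomm (c := star q) (by simpa using hq)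
    (contr_star hT.contr₁) ?_) h
  have e : T₁ * (T₁ * T₂) = q • ((T₁ * T₂) * T₁) := by
    conv_lhs => rw [show T₁ * T₂ = q • (T₂ * T₁) from hT.qcomm]
    rw [mul_smul_comm, mul_assoc]
  have := congrArg star e
  rwa [star_mul, star_smul, star_mul (T₁ * T₂)] at this

theorem Xstar_snd {q : ℂ} (hq : ‖q‖ = 1) {T₁ T₂ : H →L[ℂ] H}
    (hT : IsQCommutingContractivePair q T₁ T₂) (h : H) :
    Xstar (T₁ * T₂) hT.contr_mul T₂ (toRanQ (T₁ * T₂) hT.contr_mul h)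
      = toRanQ (T₁ * T₂) hT.contr_mul (star T₂ h) := by
  refine Xstar_apply (norm_pow_apply_le_of_qcomm hq (contr_star hT.contr₂) ?_) h
  have e : (T₁ * T₂) * T₂ = q • (T₂ * (T₁ * T₂)) := by
    conv_lhs => rw [show T₁ * T₂ = q • (T₂ * T₁) from hT.qcomm]
    rw [smul_mul_assoc, mul_assoc]
  have hqq : q * star q = 1 := by
    rw [Complex.star_def, Complex.mul_conj, Complex.normSq_eq_norm_sq, hq]
    simp
  have := congrArg star e
  rw [star_mul, star_smul, star_mul T₂] at this
  rw [this, smul_smul, hqq, one_smul]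

end AsymptoticLimit

section UnitaryExtension

variable {E : Type*} [NormedAddCommGroup E] [InnerProductSpace ℂ E]
variable {K : Type*} [NormedAddCommGroup K] [InnerProductSpace ℂ K] [CompleteSpace K]

/-- `U` on `K` is a minimal unitary extension of the isometry `V` on `E`, where `E` is regarded
as a subspace of `K` through the isometric embedding `j`: `U` is unitary, extends `V`, and the
subspaces `U*ⁿ E`, `n ≥ 0`, span a dense subspace of `K`. -/
structure IsMinimalUnitaryExtension (V : E →L[ℂ] E) (j : E →ₗᵢ[ℂ] K) (U : K →L[ℂ] K) : Prop where
  unitary : U ∈ unitary (K →L[ℂ] K)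
  extend : ∀ x, U (j x) = j (V x)
  minimal : (⨆ n : ℕ, (LinearMap.range j.toLinearMap).map
    ((star U ^ n : K →L[ℂ] K) : K →ₗ[ℂ] K)).topologicalClosure = ⊤

end UnitaryExtension

section CanonicalPair

variable {H : Type*} [NormedAddCommGroup H] [InnerProductSpace ℂ H] [CompleteSpace H]
variable {K : Type*} [NormedAddCommGroup K] [InnerProductSpace ℂ K] [CompleteSpace K]

/-- `(K, j, W_D)` is a realization of `(𝒬_{T*}, closure (ran Q_{T*}) ⊆ 𝒬_{T*}, W_D)`: the operator
`W_D*` on `K` is a minimal unitary extension of the isometry `X*`, `X* Q_{T*} h = Q_{T*} T* h`. -/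
def IsDouglasUnitary (T : H →L[ℂ] H) (hT : ‖T‖ ≤ 1) (j : ranQ T hT →ₗᵢ[ℂ] K)
    (WD : K →L[ℂ] K) : Prop :=
  IsMinimalUnitaryExtension (Xstar T hT T) j (star WD)

/-- `(W₁, W₂)` is a canonical `q`-commuting unitary pair associated with `(T₁, T₂)`, on the
realization `(K, j, W_D)` of `𝒬_{T*}`, where `T = T₁ T₂`: a `q`-commuting pair of unitaries such
that `W₁*`, `W₂*` extend `X₁*`, `X₂*` and `W₁* W₂* = q W_D*`. -/
structure IsCanonicalUnitaryPair (q : ℂ) (T₁ T₂ : H →L[ℂ] H)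
    (hT : IsQCommutingContractivePair q T₁ T₂)
    (j : ranQ (T₁ * T₂) hT.contr_mul →ₗᵢ[ℂ] K) (WD W₁ W₂ : K →L[ℂ] K) : Prop where
  douglas : IsDouglasUnitary (T₁ * T₂) hT.contr_mul j WD
  unitary₁ : W₁ ∈ unitary (K →L[ℂ] K)
  unitary₂ : W₂ ∈ unitary (K →L[ℂ] K)
  qcomm : IsQCommuting q W₁ W₂
  extend₁ : ∀ x, star W₁ (j x) = j (Xstar (T₁ * T₂) hT.contr_mul T₁ x)
  extend₂ : ∀ x, star W₂ (j x) = j (Xstar (T₁ * T₂) hT.contr_mul T₂ x)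
  prod : star W₁ * star W₂ = q • star WD

end CanonicalPair

/-- Two pairs of operators are (jointly) unitarily equivalent: one unitary intertwines both
coordinates. -/
def PairUnitarilyEquivalent {H H' : Type*} [NormedAddCommGroup H] [InnerProductSpace ℂ H]
    [NormedAddCommGroup H'] [InnerProductSpace ℂ H']
    (A₁ A₂ : H →L[ℂ] H) (B₁ B₂ : H' →L[ℂ] H') : Prop :=
  ∃ ψ : H ≃ₗᵢ[ℂ] H', (∀ h, ψ (A₁ h) = B₁ (ψ h)) ∧ (∀ h, ψ (A₂ h) = B₂ (ψ h))

end QCommuting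

end

universe u v w w'

noncomputable section

namespace QCommuting

/-! ### Isometries defined on a dense range -/

section DenseExtension

variable {F E₁ E₂ : Type*} [AddCommGroup F] [Module ℂ F]
  [NormedAddCommGroup E₁] [InnerProductSpace ℂ E₁]
  [NormedAddCommGroup E₂] [InnerProductSpace ℂ E₂] [CompleteSpace E₂]

/-! Everything rests on a universal property. Let `U` on `K` be a minimal unitary extension of an
isometry `V` on `E`. Every isometry `f : E → K'` with `U' f = f V`, `U'` unitary, extends uniquely
to an isometry `Φ : K → K'` with `Φ U = U' Φ` (`exists_isometric_intertwiner`, `intertwiner_ext`).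
Such a `Φ` must send `U*ⁿ x` to `U'*ⁿ (f x)`, and it exists because a large power of `U` moves a
finite sum of vectors `U*ⁿ xₙ` into `E`, so that its norm depends on `V` alone.

The target may be the same space with `U' = qU`. The operators `X₁*`, `X₂*` are isometries with `X₂*
X₁* = X*` and `X₁* X₂* = q X*`, hence `X₁* X* = q X* X₁*`. So `X₁*` extends to an intertwiner of
`W_D*` with `q W_D*`, and `X₂*` to one of `W_D*` with `q̄ W_D*`. By uniqueness the product relations
extend as well; they force both extensions to be unitary, and the adjoints form a canonical pair.

Conversely, in every canonical pair `W₁*` intertwines `W_D*` with `q W_D*`, which determines it, and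
`W₂ = W₁* W_D`. For equivalent pairs, `ψ` induces an isometry between the ranges because `‖Q h‖` is
the limit of `‖T*ⁿ h‖`. It lifts to a unitary `Φ`, and `Φ W₁* = W₁'* Φ` by uniqueness again. -/

theorem exists_linearIsometry_of_denseRange (e : F →ₗ[ℂ] E₁) (he : DenseRange e)
    (g : F →ₗ[ℂ] E₂) (hg : ∀ x, ‖g x‖ = ‖e x‖) :
    ∃ Φ : E₁ →ₗᵢ[ℂ] E₂, ∀ x, Φ (e x) = g x := by
  have key : ∀ x, g.extendOfNorm e (e x) = g x := fun x =>
    LinearMap.extendOfNorm_eq he ⟨1, fun x => by rw [hg, one_mul]⟩ x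
  refine ⟨⟨(g.extendOfNorm e : E₁ →ₗ[ℂ] E₂), fun y => ?_⟩, key⟩
  refine he.induction_on (p := fun y => ‖g.extendOfNorm e y‖ = ‖y‖) y
    (isClosed_eq (by fun_prop) (by fun_prop)) fun x => ?_
  rw [key, hg]

end DenseExtension

/-! ### Unitary operators -/

section Unitary

theorem mul_star_self_of_norm_eq_one {c : ℂ} (hc : ‖c‖ = 1) : c * star c = 1 := by
  rw [Complex.star_def, Complex.mul_conj, Complex.normSq_eq_norm_sq, hc]
  simp

variable {K : Type*} [NormedAddCommGroup K] [InnerProductSpace ℂ K] [CompleteSpace K]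

theorem star_apply_apply_of_mem_unitary {U : K →L[ℂ] K} (hU : U ∈ unitary (K →L[ℂ] K)) (x : K) :
    star U (U x) = x := by
  rw [← mul_apply_eq_comp, Unitary.star_mul_self_of_mem hU]; rfl

theorem apply_star_apply_of_mem_unitary {U : K →L[ℂ] K} (hU : U ∈ unitary (K →L[ℂ] K)) (x : K) :
    U (star U x) = x := by
  rw [← mul_apply_eq_comp, Unitary.mul_star_self_of_mem hU]; rfl

theorem norm_apply_of_mem_unitary {U : K →L[ℂ] K} (hU : U ∈ unitary (K →L[ℂ] K)) (x : K) :
    ‖U x‖ = ‖x‖ :=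
  (ContinuousLinearMap.norm_map_iff_adjoint_comp_self U).2 (Unitary.star_mul_self_of_mem hU) x

/-- For an isometry the adjoint is a left inverse, so it equals any right inverse. -/
theorem mem_unitary_of_norm_map_of_rightInverse {U R : K →L[ℂ] K} (hU : ∀ x, ‖U x‖ = ‖x‖)
    (hR : U * R = 1) : U ∈ unitary (K →L[ℂ] K) := by
  have h1 : star U * U = 1 := (ContinuousLinearMap.norm_map_iff_adjoint_comp_self U).1 hU
  refine Unitary.mem_iff.2 ⟨h1, ?_⟩
  rwa [left_inv_eq_right_inv h1 hR]

theorem smul_mem_unitary_of_norm_eq_one {c : ℂ} (hc : ‖c‖ = 1) {U : K →L[ℂ] K}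
    (hU : U ∈ unitary (K →L[ℂ] K)) : c • U ∈ unitary (K →L[ℂ] K) := by
  have h : star c * c = 1 := by rw [mul_comm, mul_star_self_of_norm_eq_one hc]
  refine Unitary.mem_iff.2 ⟨?_, ?_⟩
  · rw [star_smul, smul_mul_smul_comm, h, Unitary.star_mul_self_of_mem hU, one_smul]
  · rw [star_smul, smul_mul_smul_comm, mul_comm c, h, Unitary.mul_star_self_of_mem hU, one_smul]

end Unitary

/-! ### Universal property of minimal unitary extensions -/

namespace IsMinimalUnitaryExtension

theorem pow_apply_of_extend {E K : Type*} [NormedAddCommGroup E]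
    [InnerProductSpace ℂ E] [NormedAddCommGroup K] [InnerProductSpace ℂ K]
    {V : E →L[ℂ] E} {U : K →L[ℂ] K} {f : E →ₗᵢ[ℂ] K} (hf : ∀ x, U (f x) = f (V x)) (n : ℕ) (x : E) :
    (U ^ n) (f x) = f ((V ^ n) x) := by
  induction n with
  | zero => rfl
  | succ n ih => rw [pow_succ', pow_succ', mul_apply_eq_comp, mul_apply_eq_comp, ih, hf]

variable {E : Type*} [NormedAddCommGroup E] [InnerProductSpace ℂ E]
variable {K : Type*} [NormedAddCommGroup K] [InnerProductSpace ℂ K] [CompleteSpace K]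
variable {K' : Type*} [NormedAddCommGroup K'] [InnerProductSpace ℂ K'] [CompleteSpace K']
variable {V : E →L[ℂ] E} {j : E →ₗᵢ[ℂ] K} {U : K →L[ℂ] K}

/-- Intertwiners of `U` with a unitary are determined by their values on `E`. -/
theorem intertwiner_ext (h : IsMinimalUnitaryExtension V j U) {U' : K' →L[ℂ] K'}
    (hU' : U' ∈ _root_.unitary (K' →L[ℂ] K')) {A B : K →L[ℂ] K'} (hA : ∀ y, A (U y) = U' (A y))
    (hB : ∀ y, B (U y) = U' (B y)) (hAB : ∀ x, A (j x) = B (j x)) : A = B := by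
  -- As `U` and `U'` are invertible with inverses their adjoints, an intertwiner also intertwines
  -- the adjoints.
  have hstar : ∀ {C : K →L[ℂ] K'}, (∀ y, C (U y) = U' (C y)) →
      ∀ y, C (star U y) = star U' (C y) := fun {C} hC y => by
    rw [← star_apply_apply_of_mem_unitary hU' (C (star U y)), ← hC,
      apply_star_apply_of_mem_unitary h.unitary]
  have hle : (⨆ n : ℕ, (LinearMap.range j.toLinearMap).map
      ((star U ^ n : K →L[ℂ] K) : K →ₗ[ℂ] K)) ≤ LinearMap.eqLocus (A : K →ₗ[ℂ] K') (B : K →ₗ[ℂ] K') := by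
    refine iSup_le fun n => ?_
    rintro _ ⟨_, ⟨x, rfl⟩, rfl⟩
    change A ((star U ^ n) (j x)) = B ((star U ^ n) (j x))
    induction n with
    | zero => exact hAB x
    | succ n ih => rw [pow_succ', mul_apply_eq_comp, hstar hA, hstar hB, ih]
  have hcl := Submodule.topologicalClosure_minimal _ hle
    (isClosed_eq A.continuous B.continuous)
  rw [h.minimal] at hcl
  exact ContinuousLinearMap.ext fun y => hcl (Submodule.mem_top (x := y))

/-- The map sending a finitely supported sequence `x` to `∑ n, U*ⁿ (f (x n))`. -/
def backwardSum (f : E →ₗᵢ[ℂ] K) (U : K →L[ℂ] K) : (ℕ →₀ E) →ₗ[ℂ] K :=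
  Finsupp.lsum ℕ fun n => ((star U ^ n : K →L[ℂ] K) : K →ₗ[ℂ] K) ∘ₗ f.toLinearMap

theorem backwardSum_apply (f : E →ₗᵢ[ℂ] K) (U : K →L[ℂ] K) (x : ℕ →₀ E) :
    backwardSum f U x = x.sum fun n y => (star U ^ n) (f y) := rfl

theorem backwardSum_single (f : E →ₗᵢ[ℂ] K) (U : K →L[ℂ] K) (n : ℕ) (y : E) :
    backwardSum f U (Finsupp.single n y) = (star U ^ n) (f y) := by
  simp [backwardSum_apply]

/-- Apply the unitary `U ^ N`: each `U*ⁿ (f y)` becomes `f (V ^ (N - n) y)`. The right-hand side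
mentions neither `f` nor `U`, so sums formed in two different spaces can be compared. -/
theorem norm_backwardSum (hU : U ∈ _root_.unitary (K →L[ℂ] K)) {f : E →ₗᵢ[ℂ] K}
    (hf : ∀ x, U (f x) = f (V x)) (x : ℕ →₀ E) {N : ℕ} (hN : ∀ n ∈ x.support, n ≤ N) :
    ‖backwardSum f U x‖ = ‖x.sum fun n y => (V ^ (N - n)) y‖ := by
  rw [← norm_apply_of_mem_unitary (pow_mem hU N), ← f.norm_map, backwardSum_apply, Finsupp.sum,
    Finsupp.sum, map_sum, map_sum]
  congr 1
  refine Finset.sum_congr rfl fun n hn => ?_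
  have e : U ^ N * star U ^ n = U ^ (N - n) := by
    rw [← star_pow]
    conv_lhs => rw [← Nat.sub_add_cancel (hN n hn), pow_add, mul_assoc,
      Unitary.mul_star_self_of_mem (pow_mem hU n), mul_one]
  rw [← mul_apply_eq_comp, e, pow_apply_of_extend hf]

theorem denseRange_backwardSum (h : IsMinimalUnitaryExtension V j U) :
    DenseRange (backwardSum j U) := by
  have hle : (⨆ n : ℕ, (LinearMap.range j.toLinearMap).map
      ((star U ^ n : K →L[ℂ] K) : K →ₗ[ℂ] K)) ≤ LinearMap.range (backwardSum j U) := by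
    refine iSup_le fun n => ?_
    rintro _ ⟨_, ⟨x, rfl⟩, rfl⟩
    exact ⟨Finsupp.single n x, backwardSum_single j U n x⟩
  have h1 := Submodule.topologicalClosure_mono hle
  rw [h.minimal, top_le_iff] at h1
  intro y
  have : y ∈ (LinearMap.range (backwardSum j U)).topologicalClosure := h1 ▸ Submodule.mem_top
  exact this

/-- Corresponding backward sums in `K` and `K'` have equal norms, and those in `K` are dense. No
minimality is asked of `U'`, which lets `f` be an inclusion followed by a further isometry and `U'`
a rotated copy of `U`. -/
theorem exists_isometric_intertwiner (h : IsMinimalUnitaryExtension V j U) {U' : K' →L[ℂ] K'}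
    (hU' : U' ∈ _root_.unitary (K' →L[ℂ] K')) {f : E →ₗᵢ[ℂ] K'} (hf : ∀ x, U' (f x) = f (V x)) :
    ∃ Φ : K →ₗᵢ[ℂ] K', (∀ x, Φ (j x) = f x) ∧ ∀ y, Φ (U y) = U' (Φ y) := by
  obtain ⟨Φ, hΦ⟩ := exists_linearIsometry_of_denseRange (backwardSum j U)
    h.denseRange_backwardSum (backwardSum f U') fun x => by
      have hN : ∀ n ∈ x.support, n ≤ x.support.sup id := fun n hn => Finset.le_sup (f := id) hn
      rw [norm_backwardSum hU' hf x hN, norm_backwardSum h.unitary h.extend x hN]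
  have hj : ∀ n x, Φ ((star U ^ n) (j x)) = (star U' ^ n) (f x) := fun n x => by
    simpa only [backwardSum_single] using hΦ (Finsupp.single n x)
  refine ⟨Φ, hj 0, fun y => ?_⟩
  refine h.denseRange_backwardSum.induction_on (p := fun y => Φ (U y) = U' (Φ y)) y
    (isClosed_eq (by fun_prop) (by fun_prop)) fun x => ?_
  induction x using Finsupp.induction_linear with
  | zero => simp
  | add x x' hx hx' => simp only [map_add, hx, hx']
  | single n x =>
    -- For `n = 0` the relation is the hypothesis on `f`; for larger `n`, `U` and `U'` each cancel
    -- one adjoint factor.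
    rw [backwardSum_single, hj]
    cases n with
    | zero =>
      change Φ (U (j x)) = U' (f x)
      rw [h.extend, hf]
      exact hj 0 _
    | succ n =>
      rw [pow_succ', pow_succ', mul_apply_eq_comp, mul_apply_eq_comp,
        apply_star_apply_of_mem_unitary h.unitary, apply_star_apply_of_mem_unitary hU', hj]

end IsMinimalUnitaryExtension

/-! ### A sequence model of the minimal unitary extension -/

section ExistsMinimalUnitaryExtension

variable {E : Type*} [NormedAddCommGroup E]

theorem memℓp_two_iff_summable_sq {f : ℕ → E} : Memℓp f 2 ↔ Summable fun n => ‖f n‖ ^ 2 := by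
  rw [memℓp_gen_iff (by simp)]
  simp

theorem hasSum_norm_sq_lp (f : lp (fun _ : ℕ => E) 2) :
    HasSum (fun n => ‖f n‖ ^ 2) (‖f‖ ^ 2) := by
  simpa using lp.hasSum_norm (p := 2) (by simp) f

theorem memℓp_of_succ_eq {f g : ℕ → E} (hf : Memℓp f 2) {k l : ℕ}
    (h : ∀ n, g (n + k) = f (n + l)) : Memℓp g 2 := by
  rw [memℓp_two_iff_summable_sq] at hf ⊢
  rw [← summable_nat_add_iff k]
  simpa only [h] using (summable_nat_add_iff l).2 hf

variable [InnerProductSpace ℂ E] [CompleteSpace E]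

/-- The square summable sequences `y` in `E` with `V* (y n) = 0` for `n ≥ 1`. -/
def dilationSpace (V : E →L[ℂ] E) : Submodule ℂ (lp (fun _ : ℕ => E) 2) where
  carrier := {y | ∀ n, star V (y (n + 1)) = 0}
  zero_mem' n := by simp
  add_mem' hy hz n := by simp [hy n, hz n]
  smul_mem' c y hy n := by simp [hy n]

theorem isClosed_dilationSpace (V : E →L[ℂ] E) :
    IsClosed (dilationSpace V : Set (lp (fun _ : ℕ => E) 2)) := by
  change IsClosed {y : lp (fun _ : ℕ => E) 2 | ∀ n, star V (y (n + 1)) = 0}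
  rw [Set.ofPred_forall]
  refine isClosed_iInter fun n => isClosed_eq ?_ continuous_const
  exact (star V).continuous.comp (lp.evalCLM ℂ (fun _ : ℕ => E) 2 (n + 1)).continuous

instance (V : E →L[ℂ] E) : CompleteSpace (dilationSpace V) :=
  (isClosed_dilationSpace V).completeSpace_coe

theorem dilationSpace_star_apply {V : E →L[ℂ] E} (y : dilationSpace V) (n : ℕ) :
    star V (y.1 (n + 1)) = 0 := y.2 n

/-- `(y₀, y₁, y₂, …) ↦ (V y₀ + y₁, y₂, y₃, …)`. -/
def dilationMap (V : E →L[ℂ] E) : dilationSpace V →ₗ[ℂ] dilationSpace V where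
  toFun y := ⟨⟨fun n => Nat.casesOn n (V (y.1 0) + y.1 1) fun n => y.1 (n + 2),
    memℓp_of_succ_eq (k := 1) (l := 2) y.1.2 fun _ => rfl⟩, fun n => y.2 (n + 1)⟩
  map_add' y z := by
    ext n
    cases n with
    | zero =>
      change V (y.1 0 + z.1 0) + (y.1 1 + z.1 1) = V (y.1 0) + y.1 1 + (V (z.1 0) + z.1 1)
      rw [map_add]
      abel
    | succ n => rfl
  map_smul' c y := by
    ext n
    cases n with
    | zero =>
      change V (c • y.1 0) + c • y.1 1 = c • (V (y.1 0) + y.1 1)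
      rw [map_smul, smul_add]
    | succ n => rfl

theorem dilationMap_zero {V : E →L[ℂ] E} (y : dilationSpace V) :
    (dilationMap V y).1 0 = V (y.1 0) + y.1 1 := rfl

theorem dilationMap_succ {V : E →L[ℂ] E} (y : dilationSpace V) (n : ℕ) :
    (dilationMap V y).1 (n + 1) = y.1 (n + 2) := rfl

/-- The entry `y₁` lies in `ker V*`, which is orthogonal to `ran V`, so Pythagoras handles the
zeroth coordinate; the others are only shifted. -/
theorem norm_dilationMap {V : E →L[ℂ] E} (hV : ∀ x, ‖V x‖ = ‖x‖) (y : dilationSpace V) :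
    ‖dilationMap V y‖ = ‖y‖ := by
  have h1 := (hasSum_nat_add_iff' 1).2 (hasSum_norm_sq_lp (dilationMap V y).1)
  -- Dropping one term of the image and two terms of `y` leaves the same tail.
  have h2 := (hasSum_nat_add_iff' 2).2 (hasSum_norm_sq_lp y.1)
  have h3 := h1.unique h2
  have h4 : ‖V (y.1 0) + y.1 1‖ ^ 2 = ‖y.1 0‖ ^ 2 + ‖y.1 1‖ ^ 2 := by
    have : inner ℂ (V (y.1 0)) (y.1 1) = 0 := by
      rw [← ContinuousLinearMap.adjoint_inner_right, ← ContinuousLinearMap.star_eq_adjoint,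
        dilationSpace_star_apply y 0, inner_zero_right]
    rw [@norm_add_sq ℂ, this, hV]
    simp
  rw [Finset.sum_range_one, Finset.sum_range_succ, Finset.sum_range_one, dilationMap_zero, h4] at h3
  have h5 : ‖dilationMap V y‖ ^ 2 = ‖y‖ ^ 2 := by
    change ‖(dilationMap V y).1‖ ^ 2 = ‖y.1‖ ^ 2
    linarith
  exact (sq_eq_sq₀ (norm_nonneg _) (norm_nonneg _)).1 h5

theorem dilationMap_surjective {V : E →L[ℂ] E} (hV : ∀ x, ‖V x‖ = ‖x‖) :
    Function.Surjective (dilationMap V) := by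
  have hV' : ∀ x, star V (V x) = x := fun x => by
    rw [← mul_apply_eq_comp]
    exact DFunLike.congr_fun ((ContinuousLinearMap.norm_map_iff_adjoint_comp_self V).1 hV) x
  intro z
  -- The preimage splits `z₀` along `E = ran V ⊕ ker V*`, as `V (V* z₀)` plus the remainder, and
  -- shifts the other entries.
  let y : ℕ → E := fun n => Nat.casesOn n (star V (z.1 0)) fun n =>
    Nat.casesOn n (z.1 0 - V (star V (z.1 0))) fun n => z.1 (n + 1)
  refine ⟨⟨⟨y, memℓp_of_succ_eq (k := 2) (l := 1) z.1.2 fun _ => rfl⟩, fun n => ?_⟩, ?_⟩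
  · cases n with
    | zero =>
      change star V (z.1 0 - V (star V (z.1 0))) = 0
      rw [map_sub, hV', sub_self]
    | succ n => exact z.2 n
  · ext n
    cases n with
    | zero => exact add_sub_cancel _ _
    | succ n => rfl

/-- `dilationMap`, as a unitary equivalence. -/
def dilationEquiv (V : E →L[ℂ] E) (hV : ∀ x, ‖V x‖ = ‖x‖) :
    dilationSpace V ≃ₗᵢ[ℂ] dilationSpace V :=
  LinearIsometryEquiv.ofSurjective ⟨dilationMap V, norm_dilationMap hV⟩ (dilationMap_surjective hV)

/-- The embedding `x ↦ (x, 0, 0, …)`. -/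
def dilationEmbedding (V : E →L[ℂ] E) : E →ₗᵢ[ℂ] dilationSpace V where
  toFun x := ⟨lp.single 2 0 x, fun n => by simp [lp.single_apply]⟩
  map_add' x y := Subtype.ext (by simp)
  map_smul' c x := Subtype.ext (by simp)
  norm_map' x := lp.norm_single (E := fun _ : ℕ => E) (by simp) 0 x

theorem dilationEmbedding_zero {V : E →L[ℂ] E} (x : E) : (dilationEmbedding V x).1 0 = x :=
  lp.single_apply_self (E := fun _ : ℕ => E) 2 0 x

theorem dilationEmbedding_succ {V : E →L[ℂ] E} (x : E) (n : ℕ) :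
    (dilationEmbedding V x).1 (n + 1) = 0 :=
  lp.single_apply_ne (E := fun _ : ℕ => E) 2 0 x n.succ_ne_zero

theorem inner_dilationEmbedding {V : E →L[ℂ] E} (x : E) (y : dilationSpace V) :
    inner ℂ (dilationEmbedding V x) y = inner ℂ x (y.1 0) :=
  lp.inner_single_left (𝕜 := ℂ) (G := fun _ : ℕ => E) 0 x y.1

theorem dilationMap_dilationEmbedding {V : E →L[ℂ] E} (x : E) :
    dilationMap V (dilationEmbedding V x) = dilationEmbedding V (V x) := by
  ext n
  cases n with
  | zero => rw [dilationMap_zero, dilationEmbedding_zero, dilationEmbedding_succ, add_zero,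
      dilationEmbedding_zero]
  | succ n => rw [dilationMap_succ, dilationEmbedding_succ, dilationEmbedding_succ]

/-- Coordinate `m + 1` of a vector is read off from coordinate `m` of its image, once the term `V
y₀` vanishes. This gives minimality: only `0` has all its forward images orthogonal to `E`. -/
theorem dilationMap_pow_apply {V : E →L[ℂ] E} {y : dilationSpace V}
    (hy : ∀ n, ((dilationMap V ^ n) y).1 0 = 0) (m : ℕ) : ∀ k, ((dilationMap V ^ k) y).1 m = 0 := by
  induction m with
  | zero => exact hy
  | succ m ih =>
    intro k
    have h := ih (k + 1)
    rw [pow_succ', Module.End.mul_apply] at h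
    cases m with
    | zero => rwa [dilationMap_zero, hy, map_zero, zero_add] at h
    | succ m => rwa [dilationMap_succ] at h

theorem exists_isMinimalUnitaryExtension {E : Type u} [NormedAddCommGroup E]
    [InnerProductSpace ℂ E] [CompleteSpace E] (V : E →L[ℂ] E) (hV : ∀ x, ‖V x‖ = ‖x‖) :
    ∃ (K : Type u) (_ : NormedAddCommGroup K) (_ : InnerProductSpace ℂ K) (_ : CompleteSpace K)
      (j : E →ₗᵢ[ℂ] K) (U : K →L[ℂ] K), IsMinimalUnitaryExtension V j U := by
  let U : dilationSpace V →L[ℂ] dilationSpace V := (dilationEquiv V hV : _ →L[ℂ] _)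
  have hU : ∀ n y, (U ^ n) y = (dilationMap V ^ n) y := fun n y => by
    induction n with
    | zero => rfl
    | succ n ih => rw [pow_succ', pow_succ', mul_apply_eq_comp, ih]; rfl
  refine ⟨dilationSpace V, inferInstance, inferInstance, inferInstance, dilationEmbedding V,
    U, ?_, dilationMap_dilationEmbedding, ?_⟩
  · refine mem_unitary_of_norm_map_of_rightInverse (R := ((dilationEquiv V hV).symm : _ →L[ℂ] _))
      (norm_dilationMap hV) ?_
    ext1 y
    exact (dilationEquiv V hV).apply_symm_apply y
  · rw [Submodule.topologicalClosure_eq_top_iff, Submodule.eq_bot_iff]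
    intro y hy
    -- Orthogonality of `y` to `U*ⁿ E` says that `Uⁿ y` is orthogonal to `E`, the zeroth coordinate.
    have h0 : ∀ n, ((dilationMap V ^ n) y).1 0 = 0 := fun n => by
      refine ext_inner_left ℂ fun x => ?_
      rw [← inner_dilationEmbedding, ← hU, inner_zero_right,
        ← ContinuousLinearMap.adjoint_inner_left, ← ContinuousLinearMap.star_eq_adjoint, star_pow]
      exact hy _ (Submodule.mem_iSup_of_mem n ⟨_, ⟨x, rfl⟩, rfl⟩)
    ext n
    exact dilationMap_pow_apply h0 n 0

end ExistsMinimalUnitaryExtension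

/-! ### The isometries `X*`, `X₁*`, `X₂*` and their relations -/

section AsymptoticIsometries

variable {H : Type*} [NormedAddCommGroup H] [InnerProductSpace ℂ H] [CompleteSpace H]

/-- `‖Q h‖²` is the limit of `‖T*ⁿ h‖²`, and replacing `h` by `T* h` shifts this sequence by one. -/
theorem norm_toRanQ_star_apply (T : H →L[ℂ] H) (hT : ‖T‖ ≤ 1) (h : H) :
    ‖toRanQ T hT (star T h)‖ = ‖toRanQ T hT h‖ := by
  have h1 := (tendsto_norm_sq_Q T hT h).comp (tendsto_add_atTop_nat 1)
  have h2 := tendsto_norm_sq_Q T hT (star T h)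
  have h3 := tendsto_nhds_unique (h1.congr fun n => by
    simp only [Function.comp_apply, pow_succ (star T), mul_apply_eq_comp]) h2
  exact ((sq_eq_sq₀ (norm_nonneg _) (norm_nonneg _)).1 h3).symm

theorem norm_Xstar (T : H →L[ℂ] H) (hT : ‖T‖ ≤ 1) (x : ranQ T hT) :
    ‖Xstar T hT T x‖ = ‖x‖ := by
  refine (denseRange_toRanQ T hT).induction_on (p := fun x => ‖Xstar T hT T x‖ = ‖x‖) x
    (isClosed_eq (by fun_prop) (by fun_prop)) fun h => ?_
  rw [Xstar_mul, norm_toRanQ_star_apply]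

/-- Moving `S*` past `T*ⁿ` costs only a unimodular scalar, so the contractivity of `S*` survives the
limit. -/
theorem norm_Xstar_le {T : H →L[ℂ] H} {hT : ‖T‖ ≤ 1} {c : ℂ} (hc : ‖c‖ = 1) {S : H →L[ℂ] H}
    (hS : ‖S‖ ≤ 1) (hTS : S * T = c • (T * S)) (x : ranQ T hT) : ‖Xstar T hT S x‖ ≤ ‖x‖ := by
  have hTS' : star T * star S = star c • (star S * star T) := by
    rw [← star_mul, hTS, star_smul, star_mul]
  have hle := norm_pow_apply_le_of_qcomm (by simpa using hc) (contr_star hS) hTS'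
  refine (denseRange_toRanQ T hT).induction_on (p := fun x => ‖Xstar T hT S x‖ ≤ ‖x‖) x
    (isClosed_le (by fun_prop) (by fun_prop)) fun h => ?_
  rw [Xstar_apply hle]
  exact le_of_sq_le_sq (le_of_tendsto_of_tendsto' (tendsto_norm_sq_Q T hT (star S h))
    (tendsto_norm_sq_Q T hT h) fun n => by gcongr; exact hle n h) (norm_nonneg _)

variable {q : ℂ} {T₁ T₂ : H →L[ℂ] H}

theorem Xstar_snd_Xstar_fst (hq : ‖q‖ = 1) (hT : IsQCommutingContractivePair q T₁ T₂)
    (x : ranQ (T₁ * T₂) hT.contr_mul) :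
    Xstar (T₁ * T₂) hT.contr_mul T₂ (Xstar (T₁ * T₂) hT.contr_mul T₁ x)
      = Xstar (T₁ * T₂) hT.contr_mul (T₁ * T₂) x := by
  refine (denseRange_toRanQ (T₁ * T₂) hT.contr_mul).induction_on (p := fun x =>
    Xstar (T₁ * T₂) hT.contr_mul T₂ (Xstar (T₁ * T₂) hT.contr_mul T₁ x)
      = Xstar (T₁ * T₂) hT.contr_mul (T₁ * T₂) x) x
    (isClosed_eq (by fun_prop) (by fun_prop)) fun h => ?_
  rw [Xstar_fst hq hT, Xstar_snd hq hT, Xstar_mul, star_mul, mul_apply_eq_comp]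

/-- In this order the product is `T₁* T₂* = (T₂ T₁)* = q T*`, which is where the factor `q` arises.
-/
theorem Xstar_fst_Xstar_snd (hq : ‖q‖ = 1) (hT : IsQCommutingContractivePair q T₁ T₂)
    (x : ranQ (T₁ * T₂) hT.contr_mul) :
    Xstar (T₁ * T₂) hT.contr_mul T₁ (Xstar (T₁ * T₂) hT.contr_mul T₂ x)
      = q • Xstar (T₁ * T₂) hT.contr_mul (T₁ * T₂) x := by
  refine (denseRange_toRanQ (T₁ * T₂) hT.contr_mul).induction_on (p := fun x =>
    Xstar (T₁ * T₂) hT.contr_mul T₁ (Xstar (T₁ * T₂) hT.contr_mul T₂ x)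
      = q • Xstar (T₁ * T₂) hT.contr_mul (T₁ * T₂) x) x
    (isClosed_eq (by fun_prop) (by fun_prop)) fun h => ?_
  have e : q • star (T₁ * T₂) = star T₁ * star T₂ := by
    rw [show T₁ * T₂ = q • (T₂ * T₁) from hT.qcomm, star_smul, smul_smul, mul_star_self_of_norm_eq_one hq, one_smul, star_mul]
  rw [Xstar_snd hq hT, Xstar_fst hq hT, Xstar_mul, ← map_smul, ← mul_apply_eq_comp, ← e]
  rfl

theorem norm_Xstar_fst_le (hq : ‖q‖ = 1) (hT : IsQCommutingContractivePair q T₁ T₂)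
    (x : ranQ (T₁ * T₂) hT.contr_mul) : ‖Xstar (T₁ * T₂) hT.contr_mul T₁ x‖ ≤ ‖x‖ := by
  refine norm_Xstar_le hq hT.contr₁ ?_ x
  conv_lhs => rw [show T₁ * T₂ = q • (T₂ * T₁) from hT.qcomm]
  rw [mul_smul_comm, mul_assoc]

theorem norm_Xstar_snd_le (hq : ‖q‖ = 1) (hT : IsQCommutingContractivePair q T₁ T₂)
    (x : ranQ (T₁ * T₂) hT.contr_mul) : ‖Xstar (T₁ * T₂) hT.contr_mul T₂ x‖ ≤ ‖x‖ := by
  refine norm_Xstar_le (c := star q) (by simpa using hq) hT.contr₂ ?_ x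
  conv_rhs => rw [show T₁ * T₂ = q • (T₂ * T₁) from hT.qcomm]
  rw [smul_mul_assoc, smul_smul, mul_comm (star q), mul_star_self_of_norm_eq_one hq, one_smul,
    mul_assoc]

/-- When a product of two contractions is isometric, the factor applied first is isometric. The two
orders of multiplication give this for `X₁*` and for `X₂*`. -/
theorem norm_Xstar_fst (hq : ‖q‖ = 1) (hT : IsQCommutingContractivePair q T₁ T₂)
    (x : ranQ (T₁ * T₂) hT.contr_mul) : ‖Xstar (T₁ * T₂) hT.contr_mul T₁ x‖ = ‖x‖ := by
  refine le_antisymm (norm_Xstar_fst_le hq hT x) ?_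
  rw [← norm_Xstar _ _ x, ← Xstar_snd_Xstar_fst hq hT]
  exact norm_Xstar_snd_le hq hT _

theorem norm_Xstar_snd (hq : ‖q‖ = 1) (hT : IsQCommutingContractivePair q T₁ T₂)
    (x : ranQ (T₁ * T₂) hT.contr_mul) : ‖Xstar (T₁ * T₂) hT.contr_mul T₂ x‖ = ‖x‖ := by
  refine le_antisymm (norm_Xstar_snd_le hq hT x) ?_
  have h := norm_Xstar_fst_le hq hT (Xstar (T₁ * T₂) hT.contr_mul T₂ x)
  rwa [Xstar_fst_Xstar_snd hq hT, norm_smul, hq, one_mul, norm_Xstar] at h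

theorem Xstar_fst_Xstar (hq : ‖q‖ = 1) (hT : IsQCommutingContractivePair q T₁ T₂)
    (x : ranQ (T₁ * T₂) hT.contr_mul) :
    Xstar (T₁ * T₂) hT.contr_mul T₁ (Xstar (T₁ * T₂) hT.contr_mul (T₁ * T₂) x)
      = q • Xstar (T₁ * T₂) hT.contr_mul (T₁ * T₂) (Xstar (T₁ * T₂) hT.contr_mul T₁ x) := by
  rw [← Xstar_snd_Xstar_fst hq hT, Xstar_fst_Xstar_snd hq hT]

theorem Xstar_snd_Xstar (hq : ‖q‖ = 1) (hT : IsQCommutingContractivePair q T₁ T₂)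
    (x : ranQ (T₁ * T₂) hT.contr_mul) :
    q • Xstar (T₁ * T₂) hT.contr_mul T₂ (Xstar (T₁ * T₂) hT.contr_mul (T₁ * T₂) x)
      = Xstar (T₁ * T₂) hT.contr_mul (T₁ * T₂) (Xstar (T₁ * T₂) hT.contr_mul T₂ x) := by
  rw [← map_smul, ← Xstar_fst_Xstar_snd hq hT, Xstar_snd_Xstar_fst hq hT]

end AsymptoticIsometries

/-! ### Canonical pairs: existence and uniqueness -/

section CanonicalUnitaryPair

variable {H : Type*} [NormedAddCommGroup H] [InnerProductSpace ℂ H] [CompleteSpace H]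
variable {K : Type*} [NormedAddCommGroup K] [InnerProductSpace ℂ K] [CompleteSpace K]
variable {q : ℂ} {T₁ T₂ : H →L[ℂ] H}

theorem exists_isCanonicalUnitaryPair (hq : ‖q‖ = 1) (hT : IsQCommutingContractivePair q T₁ T₂)
    {j : ranQ (T₁ * T₂) hT.contr_mul →ₗᵢ[ℂ] K} {WD : K →L[ℂ] K}
    (hWD : IsDouglasUnitary (T₁ * T₂) hT.contr_mul j WD) :
    ∃ W₁ W₂ : K →L[ℂ] K, IsCanonicalUnitaryPair q T₁ T₂ hT j WD W₁ W₂ := by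
  have hq' : ‖star q‖ = 1 := by simpa using hq
  have hqq : star q * q = 1 := by rw [mul_comm, mul_star_self_of_norm_eq_one hq]
  have hmin : IsMinimalUnitaryExtension (Xstar (T₁ * T₂) hT.contr_mul (T₁ * T₂)) j (star WD) := hWD
  have hU := hmin.unitary
  obtain ⟨X₁, hX₁⟩ : ∃ X : ranQ (T₁ * T₂) hT.contr_mul →ₗᵢ[ℂ] ranQ (T₁ * T₂) hT.contr_mul,
      ∀ x, X x = Xstar (T₁ * T₂) hT.contr_mul T₁ x := ⟨⟨_, norm_Xstar_fst hq hT⟩, fun _ => rfl⟩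
  obtain ⟨X₂, hX₂⟩ : ∃ X : ranQ (T₁ * T₂) hT.contr_mul →ₗᵢ[ℂ] ranQ (T₁ * T₂) hT.contr_mul,
      ∀ x, X x = Xstar (T₁ * T₂) hT.contr_mul T₂ x := ⟨⟨_, norm_Xstar_snd hq hT⟩, fun _ => rfl⟩
  -- The relation `X₁* X* = q X* X₁*` says that `j X₁*` intertwines `X*` with `q W_D*`; for `X₂*`
  -- the scalar is `q̄`.
  obtain ⟨Φ₁, hj₁, hΦ₁⟩ := hmin.exists_isometric_intertwiner
    (smul_mem_unitary_of_norm_eq_one hq hU)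
    (f := j.comp X₁) fun x => by
      simp only [LinearIsometry.coe_comp, Function.comp_apply]
      rw [hX₁, hX₁, _root_.smul_apply,
        Xstar_fst_Xstar hq hT, hmin.extend, map_smul]
  obtain ⟨Φ₂, hj₂, hΦ₂⟩ := hmin.exists_isometric_intertwiner
    (smul_mem_unitary_of_norm_eq_one hq' hU)
    (f := j.comp X₂) fun x => by
      simp only [LinearIsometry.coe_comp, Function.comp_apply]
      rw [hX₂, hX₂, _root_.smul_apply,
        hmin.extend, ← Xstar_snd_Xstar hq hT, map_smul, smul_smul, hqq, one_smul]
  simp only [LinearIsometry.coe_comp, Function.comp_apply, hX₁] at hj₁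
  simp only [LinearIsometry.coe_comp, Function.comp_apply, hX₂] at hj₂
  change ∀ y, Φ₁ (star WD y) = q • star WD (Φ₁ y) at hΦ₁
  change ∀ y, Φ₂ (star WD y) = star q • star WD (Φ₂ y) at hΦ₂
  let A₁ : K →L[ℂ] K := Φ₁.toContinuousLinearMap
  let A₂ : K →L[ℂ] K := Φ₂.toContinuousLinearMap
  -- The scalars `q` and `q̄` cancel, so the product commutes with `W_D*`; it agrees with `W_D*` on
  -- `E`, hence everywhere.
  have h21 : A₂ * A₁ = star WD := by
    refine hmin.intertwiner_ext hU (fun y => ?_) (fun y => rfl) fun x => ?_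
    · change Φ₂ (Φ₁ _) = star WD (Φ₂ (Φ₁ y))
      rw [hΦ₁, map_smul, hΦ₂, smul_smul, mul_comm, hqq, one_smul]
    · change Φ₂ (Φ₁ _) = _
      rw [hj₁, hj₂, Xstar_snd_Xstar_fst hq hT, hmin.extend]
  have h12 : A₁ * A₂ = q • star WD := by
    refine hmin.intertwiner_ext hU (fun y => ?_) (fun y => ?_) fun x => ?_
    · change Φ₁ (Φ₂ _) = star WD (Φ₁ (Φ₂ y))
      rw [hΦ₂, map_smul, hΦ₁, smul_smul, hqq, one_smul]
    · exact (map_smul (star WD) q _).symm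
    · change Φ₁ (Φ₂ _) = q • star WD _
      rw [hj₂, hj₁, Xstar_fst_Xstar_snd hq hT, hmin.extend, map_smul]
  -- The product `A₁ A₂ = q W_D*` is unitary, which supplies a right inverse of the isometry `A₁`;
  -- `A₂ A₁` does the same for `A₂`.
  have hu₁ : A₁ ∈ unitary (K →L[ℂ] K) :=
    mem_unitary_of_norm_map_of_rightInverse (R := A₂ * star (q • star WD)) Φ₁.norm_map <| by
      rw [← mul_assoc, h12,
        Unitary.mul_star_self_of_mem (smul_mem_unitary_of_norm_eq_one hq hU)]
  have hu₂ : A₂ ∈ unitary (K →L[ℂ] K) :=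
    mem_unitary_of_norm_map_of_rightInverse (R := A₁ * star (star WD)) Φ₂.norm_map <| by
      rw [← mul_assoc, h21, Unitary.mul_star_self_of_mem hU]
  refine ⟨star A₁, star A₂, hWD, Unitary.star_mem hu₁, Unitary.star_mem hu₂, ?_, ?_, ?_, ?_⟩
  · rw [IsQCommuting, ← star_mul, ← star_mul, h21, h12, star_smul, smul_smul,
      mul_star_self_of_norm_eq_one hq, one_smul]
  · rw [star_star]
    exact hj₁
  · rw [star_star]
    exact hj₂
  · rw [star_star, star_star, h12]

namespace IsCanonicalUnitaryPair

variable {hT : IsQCommutingContractivePair q T₁ T₂}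
  {j : ranQ (T₁ * T₂) hT.contr_mul →ₗᵢ[ℂ] K} {WD W₁ W₂ : K →L[ℂ] K}

theorem star_snd_mul_star_fst (hq : ‖q‖ = 1) (h : IsCanonicalUnitaryPair q T₁ T₂ hT j WD W₁ W₂) :
    star W₂ * star W₁ = star WD := by
  rw [← star_mul, show W₁ * W₂ = q • (W₂ * W₁) from h.qcomm, star_smul, star_mul, h.prod,
    smul_smul, mul_comm, mul_star_self_of_norm_eq_one hq, one_smul]

/-- Both sides equal `W₁* W₂* W₁*`, bracketed in two ways. -/
theorem star_fst_star_douglas (hq : ‖q‖ = 1) (h : IsCanonicalUnitaryPair q T₁ T₂ hT j WD W₁ W₂)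
    (y : K) : star W₁ (star WD y) = (q • star WD) (star W₁ y) := by
  rw [← mul_apply_eq_comp, ← mul_apply_eq_comp, ← h.prod, mul_assoc, h.star_snd_mul_star_fst hq]

theorem snd_eq (hq : ‖q‖ = 1) (h : IsCanonicalUnitaryPair q T₁ T₂ hT j WD W₁ W₂) :
    W₂ = star W₁ * WD := by
  rw [← star_star WD, ← h.star_snd_mul_star_fst hq, star_mul, star_star, star_star,
    ← mul_assoc, Unitary.star_mul_self_of_mem h.unitary₁, one_mul]

/-- `W₁*` is an intertwiner of `W_D*` with `q W_D*` whose values on `E` are prescribed, and `W₁`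
with `W_D` determines `W₂`. -/
theorem unique (hq : ‖q‖ = 1) {W₁' W₂' : K →L[ℂ] K}
    (h : IsCanonicalUnitaryPair q T₁ T₂ hT j WD W₁ W₂)
    (h' : IsCanonicalUnitaryPair q T₁ T₂ hT j WD W₁' W₂') : W₁ = W₁' ∧ W₂ = W₂' := by
  have hmin : IsMinimalUnitaryExtension (Xstar (T₁ * T₂) hT.contr_mul (T₁ * T₂)) j (star WD) :=
    h.douglas
  have h₁ : W₁ = W₁' := star_injective <|
    hmin.intertwiner_ext (smul_mem_unitary_of_norm_eq_one hq hmin.unitary)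
      (h.star_fst_star_douglas hq) (h'.star_fst_star_douglas hq)
      fun x => (h.extend₁ x).trans (h'.extend₁ x).symm
  exact ⟨h₁, by rw [h.snd_eq hq, h'.snd_eq hq, h₁]⟩

end IsCanonicalUnitaryPair

end CanonicalUnitaryPair

/-! ### Transport along a unitary equivalence -/

section UnitaryEquivalence

variable {H : Type*} [NormedAddCommGroup H] [InnerProductSpace ℂ H] [CompleteSpace H]
variable {H' : Type*} [NormedAddCommGroup H'] [InnerProductSpace ℂ H'] [CompleteSpace H']

theorem map_star_apply_of_intertwines (ψ : H ≃ₗᵢ[ℂ] H') {A : H →L[ℂ] H} {B : H' →L[ℂ] H'}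
    (h : ∀ x, ψ (A x) = B (ψ x)) (x : H) : ψ (star A x) = star B (ψ x) := by
  refine ext_inner_right ℂ fun y => ?_
  obtain ⟨z, rfl⟩ := ψ.surjective y
  rw [ψ.inner_map_map, ContinuousLinearMap.star_eq_adjoint, ContinuousLinearMap.star_eq_adjoint,
    ContinuousLinearMap.adjoint_inner_left, ContinuousLinearMap.adjoint_inner_left, ← h,
    ψ.inner_map_map]

/-- Comparing the limits of `‖T*ⁿ x‖²` avoids conjugating the square root by `ψ`. -/
theorem norm_toRanQ_map (ψ : H ≃ₗᵢ[ℂ] H') {T : H →L[ℂ] H} {T' : H' →L[ℂ] H'} (hT : ‖T‖ ≤ 1)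
    (hT' : ‖T'‖ ≤ 1) (h : ∀ x, ψ (T x) = T' (ψ x)) (x : H) :
    ‖toRanQ T' hT' (ψ x)‖ = ‖toRanQ T hT x‖ := by
  have hpow : ∀ n, ψ ((star T ^ n) x) = (star T' ^ n) (ψ x) := fun n => by
    induction n with
    | zero => rfl
    | succ n ih => rw [pow_succ', pow_succ', mul_apply_eq_comp, mul_apply_eq_comp,
        map_star_apply_of_intertwines ψ h, ih]
  refine (sq_eq_sq₀ (norm_nonneg _) (norm_nonneg _)).1
    (tendsto_nhds_unique (tendsto_norm_sq_Q T' hT' (ψ x)) ?_)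
  refine (tendsto_norm_sq_Q T hT x).congr fun n => ?_
  rw [← hpow, ψ.norm_map]

theorem exists_isometric_map_ranQ (ψ : H ≃ₗᵢ[ℂ] H') {T : H →L[ℂ] H} {T' : H' →L[ℂ] H'}
    (hT : ‖T‖ ≤ 1) (hT' : ‖T'‖ ≤ 1) (h : ∀ x, ψ (T x) = T' (ψ x)) :
    ∃ f : ranQ T hT →ₗᵢ[ℂ] ranQ T' hT', ∀ x, f (toRanQ T hT x) = toRanQ T' hT' (ψ x) :=
  exists_linearIsometry_of_denseRange (toRanQ T hT : H →ₗ[ℂ] ranQ T hT) (denseRange_toRanQ T hT)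
    ((toRanQ T' hT' : H' →ₗ[ℂ] ranQ T' hT') ∘ₗ ψ.toLinearEquiv.toLinearMap)
    (norm_toRanQ_map ψ hT hT' h)

variable {K : Type*} [NormedAddCommGroup K] [InnerProductSpace ℂ K] [CompleteSpace K]
variable {K' : Type*} [NormedAddCommGroup K'] [InnerProductSpace ℂ K'] [CompleteSpace K']

theorem IsDouglasUnitary.exists_isometric_intertwiner {T : H →L[ℂ] H} {T' : H' →L[ℂ] H'}
    {hT : ‖T‖ ≤ 1} {hT' : ‖T'‖ ≤ 1} {j : ranQ T hT →ₗᵢ[ℂ] K} {WD : K →L[ℂ] K}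
    {j' : ranQ T' hT' →ₗᵢ[ℂ] K'} {WD' : K' →L[ℂ] K'} (h : IsDouglasUnitary T hT j WD)
    (h' : IsDouglasUnitary T' hT' j' WD') (ψ : H ≃ₗᵢ[ℂ] H') (hψ : ∀ x, ψ (T x) = T' (ψ x)) :
    ∃ Φ : K →ₗᵢ[ℂ] K', (∀ x, Φ (j (toRanQ T hT x)) = j' (toRanQ T' hT' (ψ x))) ∧
      ∀ y, Φ (star WD y) = star WD' (Φ y) := by
  obtain ⟨f, hf⟩ := exists_isometric_map_ranQ ψ hT hT' hψ
  obtain ⟨Φ, hΦ, hΦ'⟩ := IsMinimalUnitaryExtension.exists_isometric_intertwiner h h'.unitary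
    (f := j'.comp f) fun x => by
      change star WD' (j' (f x)) = j' (f (Xstar T hT T x))
      rw [h'.extend]
      congr 1
      refine (denseRange_toRanQ T hT).induction_on
        (p := fun x => Xstar T' hT' T' (f x) = f (Xstar T hT T x)) x
        (isClosed_eq (by fun_prop) (by fun_prop)) fun y => ?_
      rw [hf, Xstar_mul, Xstar_mul, hf, map_star_apply_of_intertwines ψ hψ]
  refine ⟨Φ, fun x => ?_, hΦ'⟩
  rw [hΦ, ← hf]
  rfl

theorem IsDouglasUnitary.intertwiner_ext {T : H →L[ℂ] H} {hT : ‖T‖ ≤ 1}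
    {j : ranQ T hT →ₗᵢ[ℂ] K} {WD : K →L[ℂ] K} (h : IsDouglasUnitary T hT j WD)
    {U : K' →L[ℂ] K'} (hU : U ∈ unitary (K' →L[ℂ] K')) {A B : K →L[ℂ] K'}
    (hA : ∀ y, A (star WD y) = U (A y)) (hB : ∀ y, B (star WD y) = U (B y))
    (hAB : ∀ x, A (j (toRanQ T hT x)) = B (j (toRanQ T hT x))) : A = B := by
  refine IsMinimalUnitaryExtension.intertwiner_ext h hU hA hB fun x => ?_
  exact (denseRange_toRanQ T hT).induction_on (p := fun x => A (j x) = B (j x)) x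
    (isClosed_eq (by fun_prop) (by fun_prop)) hAB

theorem IsDouglasUnitary.exists_unitary_intertwiner {T : H →L[ℂ] H} {T' : H' →L[ℂ] H'}
    {hT : ‖T‖ ≤ 1} {hT' : ‖T'‖ ≤ 1} {j : ranQ T hT →ₗᵢ[ℂ] K} {WD : K →L[ℂ] K}
    {j' : ranQ T' hT' →ₗᵢ[ℂ] K'} {WD' : K' →L[ℂ] K'} (h : IsDouglasUnitary T hT j WD)
    (h' : IsDouglasUnitary T' hT' j' WD') (ψ : H ≃ₗᵢ[ℂ] H') (hψ : ∀ x, ψ (T x) = T' (ψ x)) :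
    ∃ Φ : K ≃ₗᵢ[ℂ] K', (∀ x, Φ (j (toRanQ T hT x)) = j' (toRanQ T' hT' (ψ x))) ∧
      ∀ y, Φ (star WD y) = star WD' (Φ y) := by
  obtain ⟨Φ, hj, hΦ⟩ := h.exists_isometric_intertwiner h' ψ hψ
  obtain ⟨Ψ, hj', hΨ⟩ := h'.exists_isometric_intertwiner h ψ.symm fun x => by
    rw [ψ.symm_apply_eq, hψ, ψ.apply_symm_apply]
  -- `Φ` is already isometric, so only surjectivity is missing; the lift `Ψ` of `ψ⁻¹` is a right
  -- inverse by uniqueness of intertwiners.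
  have hid : (Φ.comp Ψ).toContinuousLinearMap = ContinuousLinearMap.id ℂ K' := by
    refine h'.intertwiner_ext h'.unitary (fun y => ?_) (fun y => rfl) fun x => ?_
    · change Φ (Ψ _) = star WD' (Φ (Ψ y))
      rw [hΨ, hΦ]
    · change Φ (Ψ _) = _
      rw [hj', hj, ψ.apply_symm_apply]
      rfl
  exact ⟨LinearIsometryEquiv.ofSurjective Φ fun y => ⟨Ψ y, DFunLike.congr_fun hid y⟩, hj, hΦ⟩

theorem IsCanonicalUnitaryPair.pairUnitarilyEquivalent {q : ℂ} (hq : ‖q‖ = 1)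
    {T₁ T₂ : H →L[ℂ] H} {hT : IsQCommutingContractivePair q T₁ T₂}
    {T₁' T₂' : H' →L[ℂ] H'} {hT' : IsQCommutingContractivePair q T₁' T₂'}
    {j : ranQ (T₁ * T₂) hT.contr_mul →ₗᵢ[ℂ] K} {WD W₁ W₂ : K →L[ℂ] K}
    {j' : ranQ (T₁' * T₂') hT'.contr_mul →ₗᵢ[ℂ] K'} {WD' W₁' W₂' : K' →L[ℂ] K'}
    (h : IsCanonicalUnitaryPair q T₁ T₂ hT j WD W₁ W₂)
    (h' : IsCanonicalUnitaryPair q T₁' T₂' hT' j' WD' W₁' W₂')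
    (hTT' : PairUnitarilyEquivalent T₁ T₂ T₁' T₂') :
    PairUnitarilyEquivalent W₁ W₂ W₁' W₂' := by
  obtain ⟨ψ, hψ₁, hψ₂⟩ := hTT'
  obtain ⟨Φ, hj, hΦ⟩ := h.douglas.exists_unitary_intertwiner h'.douglas ψ fun x => by
    rw [mul_apply_eq_comp, mul_apply_eq_comp, hψ₁, hψ₂]
  -- Both sides intertwine `W_D*` with `q W_D'*`, so it suffices to compare them on the vectors `Q
  -- h`, where both give `Q' (T₁'* ψ h)`.
  have hext : (Φ : K →L[ℂ] K') ∘L star W₁ = star W₁' ∘L (Φ : K →L[ℂ] K') := by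
    refine h.douglas.intertwiner_ext (smul_mem_unitary_of_norm_eq_one hq h'.douglas.unitary)
      (fun y => ?_) (fun y => ?_) fun x => ?_
    · change Φ (star W₁ (star WD y)) = q • star WD' (Φ (star W₁ y))
      rw [h.star_fst_star_douglas hq, ← hΦ, ← map_smul]
      rfl
    · change star W₁' (Φ (star WD y)) = _
      rw [hΦ, h'.star_fst_star_douglas hq]
      rfl
    · change Φ (star W₁ _) = star W₁' (Φ _)
      rw [h.extend₁, hj, h'.extend₁, Xstar_fst hq hT, Xstar_fst hq hT', hj,
        map_star_apply_of_intertwines ψ hψ₁]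
  have h₁ : ∀ y, Φ (star W₁ y) = star W₁' (Φ y) := fun y => DFunLike.congr_fun hext y
  have hD : ∀ y, Φ (WD y) = WD' (Φ y) := fun y => by
    simpa only [star_star] using map_star_apply_of_intertwines Φ hΦ y
  refine ⟨Φ, fun y => ?_, fun y => ?_⟩
  · simpa only [star_star] using map_star_apply_of_intertwines Φ h₁ y
  · rw [h.snd_eq hq, h'.snd_eq hq, mul_apply_eq_comp, mul_apply_eq_comp, h₁, hD]

end UnitaryEquivalence

end QCommuting

end

theorem theoremT (q : ℂ) (hq : ‖q‖ = 1)
    {H : Type u} [NormedAddCommGroup H] [InnerProductSpace ℂ H] [CompleteSpace H]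
    {H' : Type v} [NormedAddCommGroup H'] [InnerProductSpace ℂ H'] [CompleteSpace H']
    (T₁ T₂ : H →L[ℂ] H) (hT : QCommuting.IsQCommutingContractivePair q T₁ T₂)
    (T₁' T₂' : H' →L[ℂ] H') (hT' : QCommuting.IsQCommutingContractivePair q T₁' T₂') :
    -- the space `𝒬_{T*}` and the unitary `W_D` exist
    (∃ (K : Type u) (_ : NormedAddCommGroup K) (_ : InnerProductSpace ℂ K) (_ : CompleteSpace K)
      (j : QCommuting.ranQ (T₁ * T₂) hT.contr_mul →ₗᵢ[ℂ] K) (WD : K →L[ℂ] K),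
      QCommuting.IsDouglasUnitary (T₁ * T₂) hT.contr_mul j WD) ∧
    -- a canonical pair exists on `𝒬_{T*}`
    (∀ (K : Type w) [NormedAddCommGroup K] [InnerProductSpace ℂ K] [CompleteSpace K]
      (j : QCommuting.ranQ (T₁ * T₂) hT.contr_mul →ₗᵢ[ℂ] K) (WD : K →L[ℂ] K),
      QCommuting.IsDouglasUnitary (T₁ * T₂) hT.contr_mul j WD →
      ∃ W₁ W₂ : K →L[ℂ] K, QCommuting.IsCanonicalUnitaryPair q T₁ T₂ hT j WD W₁ W₂) ∧
    -- canonical pairs of unitarily equivalent pairs are unitarily equivalent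
    (∀ (K : Type w) [NormedAddCommGroup K] [InnerProductSpace ℂ K] [CompleteSpace K]
      (K' : Type w') [NormedAddCommGroup K'] [InnerProductSpace ℂ K'] [CompleteSpace K']
      (j : QCommuting.ranQ (T₁ * T₂) hT.contr_mul →ₗᵢ[ℂ] K) (WD W₁ W₂ : K →L[ℂ] K)
      (j' : QCommuting.ranQ (T₁' * T₂') hT'.contr_mul →ₗᵢ[ℂ] K') (WD' W₁' W₂' : K' →L[ℂ] K'),
      QCommuting.IsCanonicalUnitaryPair q T₁ T₂ hT j WD W₁ W₂ →
      QCommuting.IsCanonicalUnitaryPair q T₁' T₂' hT' j' WD' W₁' W₂' →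
      QCommuting.PairUnitarilyEquivalent T₁ T₂ T₁' T₂' →
      QCommuting.PairUnitarilyEquivalent W₁ W₂ W₁' W₂') ∧
    -- the same pair has literally the same canonical pair
    (∀ (K : Type w) [NormedAddCommGroup K] [InnerProductSpace ℂ K] [CompleteSpace K]
      (j : QCommuting.ranQ (T₁ * T₂) hT.contr_mul →ₗᵢ[ℂ] K) (WD W₁ W₂ W₁' W₂' : K →L[ℂ] K),
      QCommuting.IsCanonicalUnitaryPair q T₁ T₂ hT j WD W₁ W₂ →
      QCommuting.IsCanonicalUnitaryPair q T₁ T₂ hT j WD W₁' W₂' →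
      W₁ = W₁' ∧ W₂ = W₂') := by
  refine ⟨?_, fun K _ _ _ j WD h => QCommuting.exists_isCanonicalUnitaryPair hq hT h,
    fun K _ _ _ K' _ _ _ j WD W₁ W₂ j' WD' W₁' W₂' h h' hTT' =>
      h.pairUnitarilyEquivalent hq h' hTT',
    fun K _ _ _ j WD W₁ W₂ W₁' W₂' h h' => h.unique hq h'⟩
  obtain ⟨K, i₁, i₂, i₃, j, U, hU⟩ := QCommuting.exists_isMinimalUnitaryExtension
    (QCommuting.Xstar (T₁ * T₂) hT.contr_mul (T₁ * T₂)) (QCommuting.norm_Xstar _ _)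
  -- `U` extends `X*`, so it plays the role of `W_D*`, and `W_D` is its adjoint.
  exact ⟨K, i₁, i₂, i₃, j, star U, by rwa [QCommuting.IsDouglasUnitary, star_star]⟩
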